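/- Let $\mathbb D=\{z\in\mathbb C:|z|<1\}$, let $\Omega\subset\mathbb C$ be a domain that is starlike with respect to $1$, and let $P$ be a conformal map of $\mathbb D$ onto $\Omega$ with $P(0)=1$. Let $\mathcal{CV}(\Omega)$ be the class of analytic functions $f$ in $\mathbb D$ with $f(0)=0$, $f'(0)=1$ such that $f'(z)\neq 0$ and $1+zf''(z)/f'(z)\in\Omega$ for all $z\in\mathbb D$; for such $f$ let $\log f'$ denote the single-valued analytic branch in $\mathbb D$ with $\log f'(0)=0$. Put $$K(z)=\int_0^z\frac{P(\zeta)-1}{\zeta}\,d\zeta,\qquad F(z)=\int_0^z e^{K(\zeta)}\,d\zeta\qquad(z\in\mathbb D).$$ Then $K$ is a convex univalent function in $\mathbb D$ (analytic and injective, with convex image $K(\mathbb D)$). For each fixed $z_0\in\mathbb D\setminus\{0\}$, the region of variability $$V_{\mathcal{CV}(\Omega)}(z_0)=\{\log f'(z_0): f\in\mathcal{CV}(\Omega)\}$$ is a convex closed Jordan domain (a convex set that is the closure of a bounded domain whose boundary is a Jordan curve), and it coincides with $K(\overline{\mathbb D}(0,|z_0|))$, where $\overline{\mathbb D}(0,r)=\{z\in\mathbb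 C:|z|\le r\}$. Furthermore, for every $\varepsilon\in\mathbb C$ with $|\varepsilon|=1$ and every function $f$ on $\mathbb D$, one has $f\in\mathcal{CV}(\Omega)$ and $\log f'(z_0)=K(\varepsilon z_0)$ if and only if $f(z)=\varepsilon^{-1}F(\varepsilon z)$ for all $z\in\mathbb D$. -/

import Mathlib

open Set Metric

noncomputable section

/-- The open unit disk `𝔻`. -/
def unitDisk : Set ℂ := ball 0 1

/-- `P` maps the unit disk conformally (holomorphically and bijectively) onto `Ω`. -/
def IsConformalOnto (P : ℂ → ℂ) (Ω : Set ℂ) : Prop :=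
  DifferentiableOn ℂ P unitDisk ∧ BijOn P unitDisk Ω

/-- `∫_0^z h(ζ) dζ`, taken along the segment `ζ = t z`, `0 ≤ t ≤ 1`. -/
def integralFromZero (h : ℂ → ℂ) (z : ℂ) : ℂ :=
  ∫ t in (0 : ℝ)..1, z * h (t * z)

/-- `K(z) = ∫_0^z ζ⁻¹ (P(ζ) - 1) dζ`. -/
def extremalK (P : ℂ → ℂ) (z : ℂ) : ℂ :=
  integralFromZero (fun ζ => ζ⁻¹ * (P ζ - 1)) z

/-- `F(z) = ∫_0^z exp(K(ζ)) dζ`. -/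
def extremalF (P : ℂ → ℂ) (z : ℂ) : ℂ :=
  integralFromZero (fun ζ => Complex.exp (extremalK P ζ)) z

/-- The class `𝒞𝒱(Ω)`: `f` is analytic in the unit disk, `f(0) = 0`, `f'(0) = 1`, and the quantity
`1 + z f''(z) / f'(z)` is defined (that is, `f'(z) ≠ 0`) and belongs to `Ω` at every `z` of the
disk. -/
def ClassCV (Ω : Set ℂ) : Set (ℂ → ℂ) :=
  {f | DifferentiableOn ℂ f unitDisk ∧ f 0 = 0 ∧ deriv f 0 = 1 ∧
    ∀ z ∈ unitDisk, deriv f z ≠ 0 ∧ 1 + z * deriv (deriv f) z / deriv f z ∈ Ω}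

/-- `L` is the single-valued branch of `log f'` in the unit disk with `log f'(0) = 0`. -/
def IsLogDerivBranch (f L : ℂ → ℂ) : Prop :=
  DifferentiableOn ℂ L unitDisk ∧ L 0 = 0 ∧ ∀ z ∈ unitDisk, Complex.exp (L z) = deriv f z

/-- The region of variability `{log f'(z₀) : f ∈ 𝒞𝒱(Ω)}`, with `log f'` the branch above. -/
def variabilityRegion (Ω : Set ℂ) (z₀ : ℂ) : Set ℂ :=
  {w | ∃ f ∈ ClassCV Ω, ∃ L, IsLogDerivBranch f L ∧ L z₀ = w}

/-- A closed Jordan domain: the closure of a bounded domain `U` whose boundary is a Jordan curve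
(the image of the circle under a continuous injection). -/
def IsClosedJordanDomain (S : Set ℂ) : Prop :=
  ∃ U : Set ℂ, IsOpen U ∧ IsConnected U ∧ Bornology.IsBounded U ∧
    (∃ γ : Circle → ℂ, Continuous γ ∧ Function.Injective γ ∧ frontier U = range γ) ∧
    S = closure U

/-- A convex univalent function in the unit disk: holomorphic and injective, with convex image. -/
def IsConvexUnivalent (h : ℂ → ℂ) : Prop :=
  DifferentiableOn ℂ h unitDisk ∧ InjOn h unitDisk ∧ Convex ℝ (h '' unitDisk)

/-- The branch of `log f'` exists for every `f` in the class. -/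
theorem exists_isLogDerivBranch {Ω : Set ℂ} {f : ℂ → ℂ} (hf : f ∈ ClassCV Ω) :
    ∃ L, IsLogDerivBranch f L := by
  obtain ⟨hd, -, h1, hz⟩ := hf
  have ho : IsOpen unitDisk := isOpen_ball
  have h0 : (0 : ℂ) ∈ unitDisk := by simp [unitDisk]
  have hd1 : DifferentiableOn ℂ (deriv f) unitDisk := hd.deriv ho
  have hd2 : DifferentiableOn ℂ (deriv (deriv f)) unitDisk := hd1.deriv ho
  have hq : DifferentiableOn ℂ (fun z => deriv (deriv f) z / deriv f z) unitDisk :=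
    hd2.div hd1 fun z hzz => (hz z hzz).1
  obtain ⟨G, hG⟩ := DifferentiableOn.isExactOn_ball hq
  have hH : ∀ z ∈ unitDisk, HasDerivAt (fun z => deriv f z * Complex.exp (-(G z - G 0))) 0 z := by
    intro z hzz
    have ha : HasDerivAt (deriv f) (deriv (deriv f) z) z :=
      (hd1.differentiableAt (ho.mem_nhds hzz)).hasDerivAt
    have hb := ((hG z hzz).sub_const (G 0)).neg.cexp
    refine (ha.mul hb).congr_deriv ?_
    have := (hz z hzz).1
    field_simp
    simp
  have hc : ∀ z ∈ unitDisk, deriv f z * Complex.exp (-(G z - G 0)) = 1 := by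
    intro z hzz
    have := ho.is_const_of_deriv_eq_zero (convex_ball (0 : ℂ) 1).isPreconnected
      (fun w hw => (hH w hw).differentiableAt.differentiableWithinAt)
      (fun w hw => (hH w hw).deriv) hzz h0
    simpa [h1] using this
  refine ⟨fun z => G z - G 0, fun z hzz => ?_, by simp, fun z hzz => ?_⟩
  · exact ((hG z hzz).sub_const _).differentiableAt.differentiableWithinAt
  · have h := hc z hzz
    rw [Complex.exp_neg] at h
    have hne := Complex.exp_ne_zero (G z - G 0)
    field_simp at h
    exact h.symm

/-- The branch of `log f'` is unique on the unit disk. -/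
theorem IsLogDerivBranch.eqOn {f L M : ℂ → ℂ} (hL : IsLogDerivBranch f L)
    (hM : IsLogDerivBranch f M) : EqOn L M unitDisk := by
  have ho : IsOpen unitDisk := isOpen_ball
  have h0 : (0 : ℂ) ∈ unitDisk := by simp [unitDisk]
  have key : ∀ {N : ℂ → ℂ}, IsLogDerivBranch f N → ∀ z ∈ unitDisk,
      deriv N z = deriv (deriv f) z / deriv f z := by
    intro N hN z hz
    have hn : HasDerivAt N (deriv N z) z := (hN.1.differentiableAt (ho.mem_nhds hz)).hasDerivAt
    have he : deriv f =ᶠ[nhds z] fun z => Complex.exp (N z) := by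
      filter_upwards [ho.mem_nhds hz] with w hw using (hN.2.2 w hw).symm
    rw [he.deriv_eq, hn.cexp.deriv, ← hN.2.2 z hz]
    have := Complex.exp_ne_zero (N z)
    field_simp
  refine ho.eqOn_of_deriv_eq (convex_ball (0 : ℂ) 1).isPreconnected hL.1 hM.1 ?_ h0
    (hL.2.1.trans hM.2.1.symm)
  intro z hz
  rw [key hL z hz, key hM z hz]

end

open Set Metric Filter Topology ComplexConjugate

/-! Put `Q = P - 1`, so that `z K'(z) = Q(z)` and `Q` is univalent onto a domain starlike about `0`.
For `f` in the class with `L = log f'` one has `z L' = z f''/f'`, which takes values in `Q(𝔻)`. The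
theorem thus rests on two facts: `K` is convex univalent (Alexander), and `z L' ≺ z K'` implies `L ≺
K`. Then `L = K ∘ w` with `w` a Schwarz function, so `‖w z₀‖ ≤ ‖z₀‖` places `L z₀` in `K` of the
closed disk, and the equality case makes `w` a rotation. Conversely, for `‖c‖ ≤ 1` a primitive of
`exp (K (c z))` lies in the class, so every value is attained.

Convexity is obtained from supporting lines (`re_conj_mul_sub_pos`, `exists_separating`). The vector
`Q a = a K'(a)` is the outward normal of `K(‖z‖ = ‖a‖)` at `K a`. If `Re (conj (Q a) * K)` is
maximal over the disk at `b`, then `‖b‖ = ‖a‖` and `Q b` is a positive multiple of `Q a`;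
starlikeness and Schwarz's lemma force `b = a`. Strict support gives injectivity, and applied at a
nearest point it separates any outside point from the image.

The subordination (`mem_image_ball_of_mul_deriv_mem`) is Jack's lemma for `W = K⁻¹ ∘ L` at a first
point where `L` leaves `K(‖z‖ < r)`. -/

/-! ### Univalent functions and Schwarz's lemma on the disk -/

lemma isOpen_unitDisk : IsOpen unitDisk := isOpen_ball

lemma zero_mem_unitDisk : (0 : ℂ) ∈ unitDisk := by simp [unitDisk]

lemma mem_unitDisk {z : ℂ} : z ∈ unitDisk ↔ ‖z‖ < 1 := by simp [unitDisk]

lemma isPreconnected_unitDisk : IsPreconnected unitDisk :=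
  (convex_ball (0 : ℂ) 1).isPreconnected

lemma half_mem_unitDisk : (1 / 2 : ℂ) ∈ unitDisk := by
  rw [mem_unitDisk]; norm_num

lemma mul_mem_unitDisk {c z : ℂ} (hc : ‖c‖ ≤ 1) (hz : z ∈ unitDisk) : c * z ∈ unitDisk := by
  rw [mem_unitDisk] at *
  rw [norm_mul]
  exact (mul_le_of_le_one_left (norm_nonneg z) hc).trans_lt hz

/-- An injective holomorphic function on the unit disk is open. -/
lemma isOpen_image_of_injOn_unitDisk {f : ℂ → ℂ} (hf : DifferentiableOn ℂ f unitDisk)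
    (hi : InjOn f unitDisk) {s : Set ℂ} (hs : s ⊆ unitDisk) (ho : IsOpen s) :
    IsOpen (f '' s) := by
  refine ((hf.analyticOnNhd isOpen_unitDisk).is_constant_or_isOpen
    isPreconnected_unitDisk).resolve_left ?_ s hs ho
  rintro ⟨w, hw⟩
  have := hi zero_mem_unitDisk half_mem_unitDisk
    ((hw _ zero_mem_unitDisk).trans (hw _ half_mem_unitDisk).symm)
  norm_num at this

/-- An injective holomorphic function on the unit disk has nonvanishing derivative and a
holomorphic inverse. -/
lemma exists_differentiableOn_inverse {f : ℂ → ℂ} (hf : DifferentiableOn ℂ f unitDisk)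
    (hi : InjOn f unitDisk) :
    (∀ z ∈ unitDisk, deriv f z ≠ 0) ∧ ∃ g : ℂ → ℂ, DifferentiableOn ℂ g (f '' unitDisk) ∧
      (∀ w ∈ f '' unitDisk, g w ∈ unitDisk ∧ f (g w) = w) ∧ ∀ z ∈ unitDisk, g (f z) = z := by
  set g := Function.invFunOn f unitDisk with hg
  have hg1 : ∀ w ∈ f '' unitDisk, g w ∈ unitDisk ∧ f (g w) = w := fun w hw =>
    ⟨Function.invFunOn_mem hw, Function.invFunOn_eq hw⟩
  have hg2 : ∀ z ∈ unitDisk, g (f z) = z := fun z hz => hi.leftInvOn_invFunOn hz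
  have hopen : IsOpen (f '' unitDisk) :=
    isOpen_image_of_injOn_unitDisk hf hi subset_rfl isOpen_unitDisk
  have hcont : ∀ z ∈ unitDisk, ContinuousAt g (f z) := by
    intro z hz
    rw [ContinuousAt, hg2 z hz, tendsto_def]
    intro V hV
    obtain ⟨O, hOV, hO, hzO⟩ := _root_.mem_nhds_iff.1 (inter_mem hV (isOpen_unitDisk.mem_nhds hz))
    have h1 := isOpen_image_of_injOn_unitDisk hf hi (fun x hx => (hOV hx).2) hO
    refine mem_of_superset (h1.mem_nhds ⟨z, hzO, rfl⟩) ?_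
    rintro _ ⟨x, hx, rfl⟩
    rw [mem_preimage, hg2 x (hOV hx).2]
    exact (hOV hx).1
  -- Critical points are isolated: otherwise `f'` vanishes identically and `f` is constant.
  have hne : ∀ z ∈ unitDisk, ∀ᶠ x in 𝓝[≠] z, deriv f x ≠ 0 := by
    intro z hz
    by_contra hcon
    have h0 := ((hf.deriv isOpen_unitDisk).analyticOnNhd
      isOpen_unitDisk).eqOn_zero_of_preconnected_of_frequently_eq_zero isPreconnected_unitDisk hz
      ((not_eventually.1 hcon).mono fun x hx => not_not.1 hx)
    have := hi zero_mem_unitDisk half_mem_unitDisk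
      (isOpen_unitDisk.is_const_of_deriv_eq_zero isPreconnected_unitDisk hf h0
        zero_mem_unitDisk half_mem_unitDisk)
    norm_num at this
  -- The inverse is continuous at `f z` and differentiable at nearby points, so the singularity is
  -- removable. The chain rule for `g ∘ f = id` then excludes `f' z = 0`.
  have hdiff : ∀ z ∈ unitDisk, DifferentiableAt ℂ g (f z) := by
    intro z hz
    refine (Complex.analyticAt_of_differentiable_on_punctured_nhds_of_continuousAt ?_
      (hcont z hz)).differentiableAt
    have h1 := eventually_nhdsWithin_iff.1 (hne z hz)
    have h2 := hcont z hz
    rw [ContinuousAt, hg2 z hz] at h2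
    filter_upwards [nhdsWithin_le_nhds (h2.eventually h1),
      nhdsWithin_le_nhds (hopen.mem_nhds ⟨z, hz, rfl⟩), self_mem_nhdsWithin] with w hw1 hw2 hw3
    obtain ⟨hgD, hgw⟩ := hg1 w hw2
    have hgz : g w ≠ z := by
      intro h
      exact hw3 (by rw [← hgw, h]; rfl)
    have h3 := hcont _ hgD
    rw [hgw] at h3
    refine (HasDerivAt.of_local_left_inverse h3
      (hf.differentiableAt (isOpen_unitDisk.mem_nhds hgD)).hasDerivAt (hw1 hgz) ?_).differentiableAt
    filter_upwards [hopen.mem_nhds hw2] with y hy using (hg1 y hy).2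
  refine ⟨fun z hz h0 => ?_, g, ?_, hg1, hg2⟩
  · have h1 := (hdiff z hz).hasDerivAt.comp z
      (hf.differentiableAt (isOpen_unitDisk.mem_nhds hz)).hasDerivAt
    have h2 : HasDerivAt (g ∘ f) 1 z := (hasDerivAt_id z).congr_of_eventuallyEq (by
      filter_upwards [isOpen_unitDisk.mem_nhds hz] with y hy using hg2 y hy)
    have := h1.unique h2
    simp [h0] at this
  · rintro _ ⟨z, hz, rfl⟩
    exact (hdiff z hz).differentiableWithinAt

/-- Schwarz's lemma on the unit disk. -/
lemma norm_le_norm_of_mapsTo_unitDisk {w : ℂ → ℂ} (hd : DifferentiableOn ℂ w unitDisk)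
    (hm : MapsTo w unitDisk unitDisk) (h0 : w 0 = 0) {z : ℂ} (hz : z ∈ unitDisk) :
    ‖w z‖ ≤ ‖z‖ :=
  Complex.norm_le_norm_of_mapsTo_ball hd (hm.mono_right ball_subset_closedBall) h0
    (mem_unitDisk.1 hz)

/-- The equality case of Schwarz's lemma on the unit disk. -/
lemma exists_eqOn_rotation {w : ℂ → ℂ} (hd : DifferentiableOn ℂ w unitDisk)
    (hm : MapsTo w unitDisk unitDisk) (h0 : w 0 = 0) {z : ℂ} (hz : z ∈ unitDisk) (hz0 : z ≠ 0)
    (he : ‖w z‖ = ‖z‖) : ∃ c : ℂ, ‖c‖ = 1 ∧ EqOn w (fun x => c * x) unitDisk := by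
  have hs : dslope w 0 z = w z / z := by
    rw [dslope_of_ne _ hz0, slope_def_field, h0, sub_zero, sub_zero]
  have hn : ‖dslope w 0 z‖ = 1 / 1 := by
    rw [hs, norm_div, he, div_self (norm_ne_zero_iff.2 hz0), div_one]
  obtain ⟨c, hc, h⟩ := Complex.affine_of_mapsTo_ball_of_exists_norm_dslope_eq_div' hd
    (by rw [h0]; exact hm.mono_right ball_subset_closedBall) ⟨z, hz, hn⟩
  refine ⟨c, by simpa using hc, fun x hx => ?_⟩
  simpa [h0, mul_comm] using h hx

/-! ### First-order conditions at a maximum of the real part -/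

/-- If the real part of a holomorphic function on the disk `‖w‖ ≤ ‖z‖` is maximal at `z`, then
`z * h'(z)` is real and nonnegative. -/
lemma mul_deriv_nonneg_of_isMaxOn {h : ℂ → ℂ} {h' z : ℂ} (hd : HasDerivAt h h' z)
    (hmax : ∀ w, ‖w‖ ≤ ‖z‖ → (h w).re ≤ (h z).re) : (z * h').im = 0 ∧ 0 ≤ (z * h').re := by
  constructor
  -- Varying the argument of `z` gives an interior maximum, hence the imaginary part; varying the
  -- modulus gives the one-sided condition on the real part.
  · have hc : HasDerivAt (fun φ : ℝ => z * Complex.exp (φ * Complex.I)) (z * Complex.I) 0 := by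
      have h1 : HasDerivAt (fun φ : ℂ => z * Complex.exp (φ * Complex.I)) (z * Complex.I)
          ((0 : ℝ) : ℂ) := by
        have := (((hasDerivAt_id ((0 : ℝ) : ℂ)).mul_const Complex.I).cexp).const_mul z
        simpa using this
      exact h1.comp_ofReal
    have h2 : HasDerivAt (fun φ : ℝ => (h (z * Complex.exp (φ * Complex.I))).re)
        (h' * (z * Complex.I)).re 0 := by
      have h3 : HasDerivAt h h' (z * Complex.exp (((0 : ℝ) : ℂ) * Complex.I)) := by simpa using hd
      exact Complex.reCLM.hasFDerivAt.comp_hasDerivAt (0 : ℝ) (h3.comp (0 : ℝ) hc)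
    have h4 : IsLocalMax (fun φ : ℝ => (h (z * Complex.exp (φ * Complex.I))).re) 0 := by
      refine Eventually.of_forall fun φ => ?_
      have := hmax (z * Complex.exp (φ * Complex.I))
        (by rw [norm_mul, Complex.norm_exp_ofReal_mul_I, mul_one])
      simpa using this
    have := h4.hasDerivAt_eq_zero h2
    simp only [Complex.mul_re, Complex.mul_im, Complex.I_re, Complex.I_im] at this ⊢
    linarith
  · have hc : HasDerivAt (fun t : ℝ => (t : ℂ) * z) z 1 := by
      have h1 : HasDerivAt (fun t : ℂ => t * z) z ((1 : ℝ) : ℂ) := by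
        simpa using (hasDerivAt_id ((1 : ℝ) : ℂ)).mul_const z
      exact h1.comp_ofReal
    have h2 : HasDerivAt (fun t : ℝ => (h ((t : ℂ) * z)).re) (h' * z).re 1 := by
      have h3 : HasDerivAt h h' (((1 : ℝ) : ℂ) * z) := by simpa using hd
      exact Complex.reCLM.hasFDerivAt.comp_hasDerivAt (1 : ℝ) (h3.comp (1 : ℝ) hc)
    rw [mul_comm]
    -- A negative radial derivative would give larger values at `t z` for `t` slightly below `1`.
    by_contra! hneg
    have h5 := (hasDerivAt_iff_tendsto_slope_left_right.1 h2).1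
    have h6 := h5.eventually (gt_mem_nhds hneg)
    have h7 : ∀ᶠ t : ℝ in 𝓝[<] 1, 0 < t := nhdsWithin_le_nhds (lt_mem_nhds one_pos)
    obtain ⟨t, ht1, ht2, ht3⟩ := (h6.and (h7.and self_mem_nhdsWithin)).exists
    have ht3 : t < 1 := ht3
    rw [slope_def_field] at ht1
    have := hmax (t * z) (by
      rw [norm_mul, Complex.norm_real, Real.norm_of_nonneg ht2.le]
      exact mul_le_of_le_one_left (norm_nonneg z) ht3.le)
    rw [div_lt_iff_of_neg (by linarith)] at ht1
    simp at ht1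
    linarith

/-- The derivative of a holomorphic function vanishes at a local maximum of its real part. -/
lemma deriv_eq_zero_of_isLocalMax_re {h : ℂ → ℂ} {h' z : ℂ} (hd : HasDerivAt h h' z)
    (hmax : IsLocalMax (fun w => (h w).re) z) : h' = 0 := by
  have h1 := Complex.reCLM.hasFDerivAt.comp z (hd.hasFDerivAt.restrictScalars ℝ)
  have h2 := hmax.hasFDerivAt_eq_zero h1
  have e1 := congrArg (fun l : ℂ →L[ℝ] ℝ => l 1) h2
  have e2 := congrArg (fun l : ℂ →L[ℝ] ℝ => l Complex.I) h2
  simp at e1 e2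
  exact Complex.ext e1 (by simpa using e2)

/-! ### Starlike univalent functions -/

/-- `Q` maps the unit disk injectively onto a domain starlike with respect to `Q 0 = 0`. -/
structure IsStarlikeUnivalent (Q : ℂ → ℂ) : Prop where
  differentiableOn : DifferentiableOn ℂ Q unitDisk
  injOn : InjOn Q unitDisk
  map_zero : Q 0 = 0
  starConvex : StarConvex ℝ 0 (Q '' unitDisk)

namespace IsStarlikeUnivalent

variable {Q : ℂ → ℂ}

lemma ne_zero (hQ : IsStarlikeUnivalent Q) {z : ℂ} (hz : z ∈ unitDisk) (h0 : z ≠ 0) :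
    Q z ≠ 0 := fun h => h0 (hQ.injOn hz zero_mem_unitDisk (h.trans hQ.map_zero.symm))

/-- If `p` is holomorphic with values in the image of `Q`, and `p 0 = 0`, then `p = Q ∘ ω` for a
Schwarz function `ω`. -/
lemma exists_schwarz (hQ : IsStarlikeUnivalent Q) {p : ℂ → ℂ}
    (hp : DifferentiableOn ℂ p unitDisk) (hp0 : p 0 = 0) (hm : MapsTo p unitDisk (Q '' unitDisk)) :
    ∃ w : ℂ → ℂ, DifferentiableOn ℂ w unitDisk ∧ MapsTo w unitDisk unitDisk ∧ w 0 = 0 ∧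
      ∀ z ∈ unitDisk, Q (w z) = p z := by
  obtain ⟨-, g, hg, hg1, hg2⟩ := exists_differentiableOn_inverse hQ.differentiableOn hQ.injOn
  refine ⟨g ∘ p, hg.comp hp hm, fun z hz => (hg1 _ (hm hz)).1, ?_, fun z hz => (hg1 _ (hm hz)).2⟩
  have := hg2 0 zero_mem_unitDisk
  rw [hQ.map_zero] at this
  rw [Function.comp_apply, hp0, this]

/-- The one place where starlikeness of the image of `Q` is used: it says that `t Q` is subordinate
to `Q`. -/
lemma exists_schwarz_smul (hQ : IsStarlikeUnivalent Q) {t : ℝ} (ht0 : 0 ≤ t) (ht1 : t ≤ 1) :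
    ∃ w : ℂ → ℂ, DifferentiableOn ℂ w unitDisk ∧ MapsTo w unitDisk unitDisk ∧ w 0 = 0 ∧
      ∀ z ∈ unitDisk, Q (w z) = t * Q z := by
  refine hQ.exists_schwarz (p := fun z => t * Q z) (hQ.differentiableOn.const_mul _)
    (by simp [hQ.map_zero]) fun z hz => ?_
  simpa using hQ.starConvex.smul_mem (mem_image_of_mem Q hz) ht0 ht1

lemma norm_le_of_eq_mul (hQ : IsStarlikeUnivalent Q) {t : ℝ} (ht0 : 0 ≤ t) (ht1 : t ≤ 1)
    {z v : ℂ} (hz : z ∈ unitDisk) (hv : v ∈ unitDisk) (h : Q v = t * Q z) : ‖v‖ ≤ ‖z‖ := by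
  obtain ⟨w, hd, hm, h0, hw⟩ := hQ.exists_schwarz_smul ht0 ht1
  rw [hQ.injOn hv (hm hz) (h.trans (hw z hz).symm)]
  exact norm_le_norm_of_mapsTo_unitDisk hd hm h0 hz

/-- Equality in Schwarz's lemma turns the subordination into `Q (c x) = t Q x` with `‖c‖ = 1`. Since
`Q'(0) ≠ 0`, comparing derivatives at `0` gives `c = t`, hence `t = 1`. -/
lemma eq_of_eq_mul_of_norm_eq (hQ : IsStarlikeUnivalent Q) {t : ℝ} (ht0 : 0 ≤ t) (ht1 : t ≤ 1)
    {z v : ℂ} (hz : z ∈ unitDisk) (hz0 : z ≠ 0) (hv : v ∈ unitDisk) (h : Q v = t * Q z)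
    (hn : ‖v‖ = ‖z‖) : v = z := by
  obtain ⟨w, hd, hm, h0, hw⟩ := hQ.exists_schwarz_smul ht0 ht1
  have hvw : v = w z := hQ.injOn hv (hm hz) (h.trans (hw z hz).symm)
  obtain ⟨c, hc, hcw⟩ := exists_eqOn_rotation hd hm h0 hz hz0 (hvw ▸ hn)
  have hQ0 := (exists_differentiableOn_inverse hQ.differentiableOn hQ.injOn).1 0 zero_mem_unitDisk
  have hdQ : HasDerivAt Q (deriv Q 0) 0 := (hQ.differentiableOn.differentiableAt
    (isOpen_unitDisk.mem_nhds zero_mem_unitDisk)).hasDerivAt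
  have h1 : HasDerivAt (fun x => Q (c * x)) (deriv Q 0 * c) 0 := by
    have h2 : HasDerivAt Q (deriv Q 0) (c * 0) := by simpa using hdQ
    exact (h2.comp (0 : ℂ) ((hasDerivAt_id (0 : ℂ)).const_mul c)).congr_deriv (by rw [mul_one])
  have h3 : HasDerivAt (fun x => Q (c * x)) (t * deriv Q 0) 0 := by
    refine (hdQ.const_mul (t : ℂ)).congr_of_eventuallyEq ?_
    filter_upwards [isOpen_unitDisk.mem_nhds zero_mem_unitDisk] with x hx
    rw [← hw x hx, hcw hx]
  have hct : c = t := by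
    have := h1.unique h3
    rw [mul_comm] at this
    exact mul_right_cancel₀ hQ0 this
  have ht : t = 1 := by
    rw [hct, Complex.norm_real, Real.norm_of_nonneg ht0] at hc
    exact hc
  rw [ht, Complex.ofReal_one, one_mul] at h
  exact hQ.injOn hv hz h

end IsStarlikeUnivalent

/-! ### Convexity of `K` on concentric disks (Alexander's theorem) -/

/-- `K` is holomorphic in the unit disk with `K 0 = 0` and `z * K'(z) = Q z`. -/
structure IsLogPrimitive (K Q : ℂ → ℂ) : Prop where
  differentiableOn : DifferentiableOn ℂ K unitDisk
  map_zero : K 0 = 0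
  mul_deriv : ∀ z ∈ unitDisk, z * deriv K z = Q z

namespace IsLogPrimitive

variable {K Q : ℂ → ℂ}

lemma hasDerivAt (hK : IsLogPrimitive K Q) {z : ℂ} (hz : z ∈ unitDisk) :
    HasDerivAt K (deriv K z) z :=
  (hK.differentiableOn.differentiableAt (isOpen_unitDisk.mem_nhds hz)).hasDerivAt

/-- Away from `0` this is `Q z ≠ 0`; at `0`, differentiating `z K' = Q` gives `K'(0) = Q'(0)`. -/
lemma deriv_ne_zero (hK : IsLogPrimitive K Q) (hQ : IsStarlikeUnivalent Q) {z : ℂ}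
    (hz : z ∈ unitDisk) : deriv K z ≠ 0 := by
  rcases eq_or_ne z 0 with rfl | h0
  · have hQ0 := (exists_differentiableOn_inverse hQ.differentiableOn hQ.injOn).1 0
      zero_mem_unitDisk
    have h1 : HasDerivAt (deriv K) (deriv (deriv K) 0) 0 :=
      ((hK.differentiableOn.deriv isOpen_unitDisk).differentiableAt
        (isOpen_unitDisk.mem_nhds hz)).hasDerivAt
    have h2 := (hasDerivAt_id (0 : ℂ)).mul h1
    have h3 : Q =ᶠ[𝓝 0] id * deriv K := by
      filter_upwards [isOpen_unitDisk.mem_nhds hz] with x hx using (hK.mul_deriv x hx).symm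
    rw [h3.deriv_eq, h2.deriv] at hQ0
    simpa using hQ0
  · intro h
    have := hK.mul_deriv z hz
    rw [h, mul_zero] at this
    exact hQ.ne_zero hz h0 this.symm

lemma closedBall_subset {r : ℝ} (hr : r < 1) : closedBall (0 : ℂ) r ⊆ unitDisk :=
  closedBall_subset_ball hr

/-- If `h'(a) = u * K'(a)` and the real part of `h` is maximal on `‖z‖ ≤ r` at `a`, then
`‖a‖ = r` and `u * Q a` is a positive real number. -/
lemma norm_eq_of_isMaxOn (hK : IsLogPrimitive K Q) (hQ : IsStarlikeUnivalent Q) {h : ℂ → ℂ}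
    {r : ℝ} (hr : r < 1) {a u : ℂ} (ha : ‖a‖ ≤ r) (hr0 : 0 < r) (hu : u ≠ 0)
    (hd : HasDerivAt h (u * deriv K a) a) (hmax : ∀ w, ‖w‖ ≤ r → (h w).re ≤ (h a).re) :
    ‖a‖ = r ∧ (u * Q a).im = 0 ∧ 0 < (u * Q a).re := by
  have haD : a ∈ unitDisk := mem_unitDisk.2 (ha.trans_lt hr)
  have hn : ‖a‖ = r := by
    refine ha.antisymm (not_lt.1 fun hlt => ?_)
    have : IsLocalMax (fun w => (h w).re) a := by
      filter_upwards [isOpen_ball.mem_nhds (mem_ball_zero_iff.2 hlt)] with w hw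
      exact hmax w (mem_ball_zero_iff.1 hw).le
    exact mul_ne_zero hu (hK.deriv_ne_zero hQ haD) (deriv_eq_zero_of_isLocalMax_re hd this)
  have ha0 : a ≠ 0 := norm_pos_iff.1 (hn ▸ hr0)
  obtain ⟨h1, h2⟩ := mul_deriv_nonneg_of_isMaxOn hd (by rwa [hn])
  rw [mul_left_comm, hK.mul_deriv a haD] at h1 h2
  refine ⟨hn, h1, lt_of_le_of_ne h2 fun h3 => ?_⟩
  exact mul_ne_zero hu (hQ.ne_zero haD ha0) (Complex.ext h3.symm h1)

/-- The strict supporting-line inequality for the curve `K '' sphere 0 r`. -/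
lemma re_conj_mul_sub_pos (hK : IsLogPrimitive K Q) (hQ : IsStarlikeUnivalent Q) {a z : ℂ}
    (haD : a ∈ unitDisk) (ha0 : a ≠ 0) (hz : ‖z‖ ≤ ‖a‖) (hne : z ≠ a) :
    0 < (conj (Q a) * (K a - K z)).re := by
  have hr := mem_unitDisk.1 haD
  have hr0 := norm_pos_iff.2 ha0
  have hQa := hQ.ne_zero haD ha0
  have hu : conj (Q a) ≠ 0 := by simpa using hQa
  -- the only point at which the maximum can be attained is `a`
  have huniq : ∀ b, ‖b‖ ≤ ‖a‖ → (∀ w, ‖w‖ ≤ ‖a‖ →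
      (conj (Q a) * K w).re ≤ (conj (Q a) * K b).re) → b = a := by
    intro b hb hmax
    have hbD : b ∈ unitDisk := mem_unitDisk.2 (hb.trans_lt hr)
    obtain ⟨hn, him, hre⟩ := hK.norm_eq_of_isMaxOn hQ hr hb hr0 hu
      ((hK.hasDerivAt hbD).const_mul _) hmax
    have hb0 : b ≠ 0 := norm_pos_iff.1 (hn ▸ hr0)
    set s := (conj (Q a) * Q b).re with hs
    have hs' : conj (Q a) * Q b = s := Complex.ext (by simp [hs]) (by simpa using him)
    set N := Complex.normSq (Q a) with hN
    have hNpos : 0 < N := Complex.normSq_pos.2 hQa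
    -- Positivity of `conj (Q a) * Q b` means that `Q a` and `Q b` lie on the same ray from `0`.
    -- Whichever of the two is shorter is a contraction of the other, and `‖a‖ = ‖b‖` then forces
    -- equality.
    have hQb : Q b = ((s / N : ℝ) : ℂ) * Q a := by
      have : (N : ℂ) * Q b = s * Q a := by
        rw [hN, Complex.normSq_eq_conj_mul_self, ← hs']; ring
      have hN0 : (N : ℂ) ≠ 0 := by exact_mod_cast hNpos.ne'
      push_cast
      field_simp
      rw [mul_comm, this, mul_comm]
    have ht : 0 < s / N := div_pos hre hNpos
    rcases le_total (s / N) 1 with h1 | h1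
    · exact hQ.eq_of_eq_mul_of_norm_eq ht.le h1 haD ha0 hbD hQb hn
    · refine (hQ.eq_of_eq_mul_of_norm_eq (inv_nonneg.2 ht.le) (inv_le_one_of_one_le₀ h1) hbD hb0
        haD ?_ hn.symm).symm
      rw [hQb, ← mul_assoc, ← Complex.ofReal_mul, inv_mul_cancel₀ ht.ne', Complex.ofReal_one,
        one_mul]
  have hcont : ContinuousOn (fun w => (conj (Q a) * K w).re) (closedBall 0 ‖a‖) :=
    Complex.continuous_re.comp_continuousOn
      ((hK.differentiableOn.continuousOn.mono (closedBall_subset hr)).const_smul (conj (Q a)))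
  obtain ⟨b, hb, hbmax⟩ := (isCompact_closedBall (0 : ℂ) ‖a‖).exists_isMaxOn
    ⟨0, by simp⟩ hcont
  have hmax : ∀ w, ‖w‖ ≤ ‖a‖ → (conj (Q a) * K w).re ≤ (conj (Q a) * K b).re := fun w hw =>
    hbmax (mem_closedBall_zero_iff.2 hw)
  obtain rfl := huniq b (mem_closedBall_zero_iff.1 hb) hmax
  rw [mul_sub, Complex.sub_re, sub_pos]
  refine lt_of_le_of_ne (hmax z hz) fun he => hne (huniq z hz fun w hw => ?_)
  rw [he]
  exact hmax w hw

lemma injOn (hK : IsLogPrimitive K Q) (hQ : IsStarlikeUnivalent Q) : InjOn K unitDisk := by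
  have key : ∀ a ∈ unitDisk, ∀ z, ‖z‖ ≤ ‖a‖ → K a = K z → z = a := by
    intro a ha z hz h
    by_contra hne
    have ha0 : a ≠ 0 := by
      rintro rfl
      exact hne (norm_le_zero_iff.1 (by simpa using hz))
    have := hK.re_conj_mul_sub_pos hQ ha ha0 hz hne
    simp [h] at this
  intro a ha z hz h
  rcases le_total ‖z‖ ‖a‖ with h1 | h1
  · exact (key a ha z h1 h).symm
  · exact key z hz a h1 h.symm

lemma isCompact_image (hK : IsLogPrimitive K Q) {r : ℝ} (hr : r < 1) :
    IsCompact (K '' closedBall 0 r) :=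
  (isCompact_closedBall 0 r).image_of_continuousOn
    (hK.differentiableOn.continuousOn.mono (closedBall_subset hr))

/-- A point outside of `K '' closedBall 0 r` is strictly separated from it by a supporting line. -/
lemma exists_separating (hK : IsLogPrimitive K Q) (hQ : IsStarlikeUnivalent Q) {r : ℝ}
    (hr0 : 0 < r) (hr : r < 1) {w : ℂ} (hw : w ∉ K '' closedBall 0 r) :
    ∃ u v : ℂ, (∀ z ∈ closedBall (0 : ℂ) r, (u * (K z - v)).re ≤ 0) ∧ 0 < (u * (w - v)).re := by
  -- The separating line is the supporting line at the point `K a` of the image nearest to `w`.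
  obtain ⟨_, ⟨a, ha, rfl⟩, hmin⟩ := (hK.isCompact_image hr).exists_infDist_eq_dist
    ⟨K 0, 0, by simp [hr0.le], rfl⟩ w
  have haD : a ∈ unitDisk := closedBall_subset hr ha
  have hne : ∀ z ∈ closedBall (0 : ℂ) r, K z - w ≠ 0 := fun z hz h =>
    hw ⟨z, hz, sub_eq_zero.1 h⟩
  have hle : ∀ z ∈ closedBall (0 : ℂ) r, ‖K a - w‖ ≤ ‖K z - w‖ := fun z hz => by
    have := infDist_le_dist_of_mem (x := w) (mem_image_of_mem K hz)
    rwa [hmin, dist_comm w, dist_comm w, dist_eq_norm, dist_eq_norm] at this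
  -- This quotient has modulus at most `1` on the disk and equals `1` at `a`, so its real part is
  -- maximal there. Consequently `Q a / (w - K a) > 0`: the normal at `K a` points towards `w`.
  have hd : HasDerivAt (fun z => (K a - w) / (K z - w)) ((w - K a)⁻¹ * deriv K a) a := by
    have h1 := (((hK.hasDerivAt haD).sub_const w).inv (hne a ha)).const_mul (K a - w)
    refine h1.congr_deriv ?_
    have h2 := hne a ha
    have h3 : w - K a ≠ 0 := fun h => h2 (by rw [← neg_sub, h, neg_zero])
    field_simp
    ring
  have hu : (w - K a)⁻¹ ≠ 0 :=
    inv_ne_zero fun h => hne a ha (by rw [← neg_sub, h, neg_zero])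
  obtain ⟨hn, him, hre⟩ := hK.norm_eq_of_isMaxOn hQ hr (mem_closedBall_zero_iff.1 ha) hr0 hu hd (by
    intro z hz
    have hz' : z ∈ closedBall (0 : ℂ) r := mem_closedBall_zero_iff.2 hz
    rw [div_self (hne a ha), Complex.one_re]
    refine (Complex.re_le_norm _).trans ?_
    rw [norm_div]
    exact div_le_one_of_le₀ (hle z hz') (norm_nonneg _))
  have ha0 : a ≠ 0 := norm_pos_iff.1 (hn ▸ hr0)
  refine ⟨conj (Q a), K a, fun z hz => ?_, ?_⟩
  · rcases eq_or_ne z a with rfl | hza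
    · simp
    · have := hK.re_conj_mul_sub_pos hQ haD ha0
        (hn.symm ▸ mem_closedBall_zero_iff.1 hz) hza
      rw [← neg_sub (K a), mul_neg, Complex.neg_re]
      linarith
  · set s := ((w - K a)⁻¹ * Q a).re with hs
    have hs' : (w - K a)⁻¹ * Q a = s := Complex.ext (by simp [hs]) (by simpa using him)
    have hQa : Q a = s * (w - K a) := by
      rw [← hs', mul_right_comm, inv_mul_cancel₀ (fun h => hu (by rw [h, inv_zero])), one_mul]
    rw [hQa, map_mul, Complex.conj_ofReal, mul_assoc, ← Complex.normSq_eq_conj_mul_self,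
      ← Complex.ofReal_mul, Complex.ofReal_re]
    exact mul_pos hre (Complex.normSq_pos.2 (fun h => hu (by rw [h, inv_zero])))

lemma convex_image_closedBall (hK : IsLogPrimitive K Q) (hQ : IsStarlikeUnivalent Q) {r : ℝ}
    (hr0 : 0 < r) (hr : r < 1) : Convex ℝ (K '' closedBall 0 r) := by
  rintro _ ⟨x, hx, rfl⟩ _ ⟨y, hy, rfl⟩ α β hα hβ hαβ
  by_contra hw
  obtain ⟨u, v, h1, h2⟩ := hK.exists_separating hQ hr0 hr hw
  have e : u * (α • K x + β • K y - v) = α * (u * (K x - v)) + β * (u * (K y - v)) := by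
    have : (α : ℂ) + β = 1 := by exact_mod_cast hαβ
    simp only [Complex.real_smul]
    linear_combination u * v * this
  rw [e, Complex.add_re, Complex.re_ofReal_mul, Complex.re_ofReal_mul] at h2
  have := mul_nonpos_of_nonneg_of_nonpos hα (h1 x hx)
  have := mul_nonpos_of_nonneg_of_nonpos hβ (h1 y hy)
  linarith

/-- Any two points of the disk lie in a common closed disk of radius `r < 1`, which reduces
convexity to `convex_image_closedBall`. -/
lemma isConvexUnivalent (hK : IsLogPrimitive K Q) (hQ : IsStarlikeUnivalent Q) :
    IsConvexUnivalent K := by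
  refine ⟨hK.differentiableOn, hK.injOn hQ, ?_⟩
  rintro _ ⟨x, hx, rfl⟩ _ ⟨y, hy, rfl⟩ α β hα hβ hαβ
  obtain ⟨r, hr, hr1⟩ := exists_between
    (max_lt (max_lt (mem_unitDisk.1 hx) (mem_unitDisk.1 hy)) zero_lt_one)
  obtain ⟨h1, hr0⟩ := max_lt_iff.1 hr
  obtain ⟨hxr, hyr⟩ := max_lt_iff.1 h1
  exact image_mono (closedBall_subset hr1) (hK.convex_image_closedBall hQ hr0 hr1
    ⟨x, mem_closedBall_zero_iff.2 hxr.le, rfl⟩ ⟨y, mem_closedBall_zero_iff.2 hyr.le, rfl⟩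
    hα hβ hαβ)

/-- The image of a closed disk is a closed Jordan domain. -/
lemma isClosedJordanDomain_image (hK : IsLogPrimitive K Q) (hQ : IsStarlikeUnivalent Q) {r : ℝ}
    (hr0 : 0 < r) (hr : r < 1) : IsClosedJordanDomain (K '' closedBall 0 r) := by
  have hsub := closedBall_subset hr
  have hinj := hK.injOn hQ
  have hcont := hK.differentiableOn.continuousOn.mono hsub
  have hopen : IsOpen (K '' ball 0 r) := isOpen_image_of_injOn_unitDisk hK.differentiableOn hinj
    (ball_subset_closedBall.trans hsub) isOpen_ball
  have hcl : closure (K '' ball 0 r) = K '' closedBall 0 r := by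
    refine (closure_minimal (image_mono ball_subset_closedBall)
      (hK.isCompact_image hr).isClosed).antisymm ?_
    rw [← closure_ball (0 : ℂ) hr0.ne'] at hcont ⊢
    exact hcont.image_closure
  refine ⟨K '' ball 0 r, hopen, ?_, ?_, ?_, hcl.symm⟩
  · exact ((convex_ball (0 : ℂ) r).isConnected ⟨0, by simpa using hr0⟩).image _
      (hcont.mono ball_subset_closedBall)
  · exact (hK.isCompact_image hr).isBounded.subset (image_mono ball_subset_closedBall)
  · have hs : ∀ c : Circle, (r : ℂ) * c ∈ closedBall (0 : ℂ) r := fun c => by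
      simp [abs_of_pos hr0, Circle.norm_coe c]
    refine ⟨fun c => K (r * c), ?_, ?_, ?_⟩
    · exact hcont.comp_continuous (by fun_prop) hs
    · intro c d h
      have := hinj (hsub (hs c)) (hsub (hs d)) h
      exact Circle.ext (mul_left_cancel₀ (by exact_mod_cast hr0.ne') this)
    · rw [frontier, hcl, hopen.interior_eq]
      ext w
      constructor
      · rintro ⟨⟨z, hz, rfl⟩, hw⟩
        have hzr : ‖z‖ = r := (mem_closedBall_zero_iff.1 hz).antisymm
          (not_lt.1 fun h => hw ⟨z, mem_ball_zero_iff.2 h, rfl⟩)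
        have hr' : (r : ℂ) ≠ 0 := by exact_mod_cast hr0.ne'
        refine ⟨⟨z / r, mem_sphere_zero_iff_norm.2 ?_⟩, ?_⟩
        · rw [norm_div, hzr, Complex.norm_real, Real.norm_of_nonneg hr0.le, div_self hr0.ne']
        · exact congrArg K (mul_div_cancel₀ z hr')
      · rintro ⟨c, rfl⟩
        refine ⟨⟨_, hs c, rfl⟩, ?_⟩
        rintro ⟨z, hz, h⟩
        have := hinj (hsub (ball_subset_closedBall hz)) (hsub (hs c)) h
        rw [this] at hz
        simp [abs_of_pos hr0, Circle.norm_coe c] at hz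

end IsLogPrimitive

/-! ### Subordination of `L` to `K` -/

namespace IsLogPrimitive

variable {K Q : ℂ → ℂ}

/-- If `z * L'(z)` takes values in `Q '' 𝔻`, then `L` maps `‖z‖ < r` into `K '' ball 0 r`. -/
lemma mem_image_ball_of_mul_deriv_mem (hK : IsLogPrimitive K Q) (hQ : IsStarlikeUnivalent Q)
    {L : ℂ → ℂ} (hL : DifferentiableOn ℂ L unitDisk) (hL0 : L 0 = 0)
    (hm : ∀ z ∈ unitDisk, z * deriv L z ∈ Q '' unitDisk) {r : ℝ} (hr : r < 1) {z : ℂ}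
    (hz : ‖z‖ < r) : L z ∈ K '' ball 0 r := by
  have hr0 : 0 < r := (norm_nonneg z).trans_lt hz
  have hinj := hK.injOn hQ
  have hsubr : ball (0 : ℂ) r ⊆ unitDisk := ball_subset_ball hr.le
  have hopen : IsOpen (K '' ball 0 r) :=
    isOpen_image_of_injOn_unitDisk hK.differentiableOn hinj hsubr isOpen_ball
  have hopenD : IsOpen (K '' unitDisk) :=
    isOpen_image_of_injOn_unitDisk hK.differentiableOn hinj subset_rfl isOpen_unitDisk
  by_contra hcon
  have hsub : closedBall (0 : ℂ) ‖z‖ ⊆ unitDisk := closedBall_subset (hz.trans hr)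
  have hcomp : IsCompact (closedBall (0 : ℂ) ‖z‖ ∩ L ⁻¹' (K '' ball 0 r)ᶜ) :=
    (isCompact_closedBall (0 : ℂ) ‖z‖).of_isClosed_subset
      ((hL.continuousOn.mono hsub).preimage_isClosed_of_isClosed isClosed_closedBall
        hopen.isClosed_compl) inter_subset_left
  -- a point of minimal modulus violating the claim
  obtain ⟨a, ⟨haz, haL⟩, hmin⟩ := hcomp.exists_isMinOn
    ⟨z, mem_closedBall_zero_iff.2 le_rfl, hcon⟩ continuous_norm.continuousOn
  have haz' : ‖a‖ ≤ ‖z‖ := mem_closedBall_zero_iff.1 haz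
  have har : ‖a‖ < r := haz'.trans_lt hz
  have haD : a ∈ unitDisk := hsub haz
  have ha0 : a ≠ 0 := by
    rintro rfl
    exact haL ⟨0, by simpa using hr0, by rw [hL0, hK.map_zero]⟩
  have hna : 0 < ‖a‖ := norm_pos_iff.2 ha0
  have hball : ∀ w ∈ ball (0 : ℂ) ‖a‖, L w ∈ K '' ball 0 r := by
    intro w hw
    by_contra h
    have hw' := mem_ball_zero_iff.1 hw
    have : ‖a‖ ≤ ‖w‖ := hmin ⟨mem_closedBall_zero_iff.2 (hw'.le.trans haz'), h⟩
    exact this.not_gt hw'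
  have hcball : ∀ w ∈ closedBall (0 : ℂ) ‖a‖, L w ∈ K '' closedBall 0 r := by
    rw [← closure_ball (0 : ℂ) hna.ne']
    have hc : ContinuousOn L (closure (ball (0 : ℂ) ‖a‖)) := by
      rw [closure_ball (0 : ℂ) hna.ne']
      exact hL.continuousOn.mono ((closedBall_subset_closedBall haz').trans hsub)
    have hsubset : L '' ball 0 ‖a‖ ⊆ K '' closedBall 0 r :=
      image_subset_iff.2 fun w hw => image_mono ball_subset_closedBall (hball w hw)
    exact fun w hw => closure_minimal hsubset (hK.isCompact_image hr).isClosed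
      (hc.image_closure ⟨w, hw, rfl⟩)
  obtain ⟨-, g, hg, hg1, hg2⟩ := exists_differentiableOn_inverse hK.differentiableOn hinj
  have hW : ∀ w ∈ closedBall (0 : ℂ) ‖a‖, DifferentiableAt ℂ (g ∘ L) w ∧ ‖g (L w)‖ ≤ r ∧
      K (g (L w)) = L w := by
    intro w hw
    have hwD : w ∈ unitDisk := hsub (closedBall_subset_closedBall haz' hw)
    obtain ⟨v, hv, hvw⟩ := hcball w hw
    have hLw : L w ∈ K '' unitDisk := ⟨v, closedBall_subset hr hv, hvw⟩
    refine ⟨(hg.differentiableAt (hopenD.mem_nhds hLw)).comp w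
      (hL.differentiableAt (isOpen_unitDisk.mem_nhds hwD)), ?_, (hg1 _ hLw).2⟩
    rw [← hvw, hg2 v (closedBall_subset hr hv)]
    exact mem_closedBall_zero_iff.1 hv
  have hW0 : (g ∘ L) 0 = 0 := by
    have := hg2 0 zero_mem_unitDisk
    rw [hK.map_zero] at this
    rw [Function.comp_apply, hL0, this]
  have haa : a ∈ closedBall (0 : ℂ) ‖a‖ := mem_closedBall_zero_iff.2 le_rfl
  obtain ⟨hWd, hWle, hKW⟩ := hW a haa
  have hWa : ‖g (L a)‖ = r := hWle.antisymm (not_lt.1 fun h =>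
    haL ⟨g (L a), mem_ball_zero_iff.2 h, hKW⟩)
  have hWa0 : g (L a) ≠ 0 := norm_pos_iff.1 (hWa ▸ hr0)
  have hWD : g (L a) ∈ unitDisk := mem_unitDisk.2 (hWa.trans_lt hr)
  -- Schwarz's lemma for `g ∘ L`, up to the boundary of the disk
  have hschwarz : ∀ w, ‖w‖ ≤ ‖a‖ → ‖g (L w)‖ ≤ r / ‖a‖ * ‖w‖ := by
    intro w hw
    rcases hw.lt_or_eq with h | h
    · have := Complex.dist_le_div_mul_dist_of_mapsTo_ball (f := g ∘ L) (c := 0) (R₁ := ‖a‖)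
        (R₂ := r) (fun x hx => (hW x (ball_subset_closedBall hx)).1.differentiableWithinAt)
        (fun x hx => by
          rw [hW0]
          exact mem_closedBall_zero_iff.2 (hW x (ball_subset_closedBall hx)).2.1)
        (mem_ball_zero_iff.2 h)
      rwa [hW0, dist_zero_right, dist_zero_right] at this
    · rw [h, div_mul_cancel₀ _ hna.ne']
      exact (hW w (mem_closedBall_zero_iff.2 hw)).2.1
  set W' := deriv (g ∘ L) a with hW'
  have hWder : HasDerivAt (g ∘ L) W' a := hWd.hasDerivAt
  -- Jack's lemma: with `W = g ∘ L`, the normalised quotient `(W w / w) / (W a / a)` is bounded by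
  -- `1` and equals `1` at `a`. Its first-order condition reads `a W'(a) = (1 + m) W(a)` with `m ≥
  -- 0` real.
  have hd : HasDerivAt (fun w => a / g (L a) * ((g ∘ L) w / w))
      (a / g (L a) * ((W' * a - g (L a) * 1) / a ^ 2)) a :=
    (hWder.div (hasDerivAt_id a) ha0).const_mul _
  obtain ⟨him, hre⟩ := mul_deriv_nonneg_of_isMaxOn hd (by
    intro w hw
    have e : a / g (L a) * ((g ∘ L) a / a) = 1 := by
      simp only [Function.comp_apply]
      field_simp
    rw [e, Complex.one_re]
    refine (Complex.re_le_norm _).trans ?_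
    rw [norm_mul, norm_div, norm_div, hWa, Function.comp_apply]
    -- At `w = 0` the quotient is `0` because `x / 0 = 0`; this value does not affect the derivative
    -- at `a ≠ 0`.
    rcases eq_or_ne w 0 with rfl | hw0
    · simp
    · have hwpos := norm_pos_iff.2 hw0
      have := hschwarz w hw
      rw [div_mul_div_comm, div_le_one (by positivity)]
      calc ‖a‖ * ‖g (L w)‖ ≤ ‖a‖ * (r / ‖a‖ * ‖w‖) := by gcongr
        _ = r * ‖w‖ := by field_simp)
  set m := a * (a / g (L a) * ((W' * a - g (L a) * 1) / a ^ 2)) with hmdef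
  have hmre : m = m.re := Complex.ext (by simp) (by simpa using him)
  have hmW : a * W' = (1 + m.re : ℝ) * g (L a) := by
    push_cast
    rw [← hmre, hmdef]
    field_simp
    ring
  -- the derivative of `L` at `a`
  have hKL : K ∘ (g ∘ L) =ᶠ[𝓝 a] L := by
    have h1 : ∀ᶠ w in 𝓝 a, L w ∈ K '' unitDisk :=
      (hL.continuousOn.continuousAt (isOpen_unitDisk.mem_nhds haD)).eventually
        (hopenD.mem_nhds ⟨g (L a), hWD, hKW⟩)
    filter_upwards [h1] with w hw using (hg1 _ hw).2
  have hderiv : deriv L a = deriv K (g (L a)) * W' := by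
    rw [← hKL.deriv_eq]
    exact ((hK.hasDerivAt hWD).comp a hWder).deriv
  have haL' : a * deriv L a = (1 + m.re : ℝ) * Q (g (L a)) := by
    rw [hderiv, ← hK.mul_deriv _ hWD]
    linear_combination deriv K (g (L a)) * hmW
  -- Now `Q (s a) = a L'(a) = (1 + m) Q (W a)`, so `Q (W a)` is a contraction of `Q (s a)`. Hence `r
  -- = ‖W a‖ ≤ ‖s a‖ ≤ ‖a‖ < r`, a contradiction.
  obtain ⟨s, hsd, hsm, hs0, hs⟩ := hQ.exists_schwarz (p := fun w => w * deriv L w)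
    (differentiableOn_id.mul (hL.deriv isOpen_unitDisk)) (by simp) hm
  have h1m : 1 ≤ 1 + m.re := by linarith
  have h1 : Q (g (L a)) = ((1 + m.re)⁻¹ : ℝ) * Q (s a) := by
    rw [hs a haD, haL', ← mul_assoc, ← Complex.ofReal_mul,
      inv_mul_cancel₀ (by linarith), Complex.ofReal_one, one_mul]
  have h2 := hQ.norm_le_of_eq_mul (inv_nonneg.2 (by linarith)) (inv_le_one_of_one_le₀ h1m)
    (hsm haD) hWD h1
  have h3 := norm_le_norm_of_mapsTo_unitDisk hsd hsm hs0 haD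
  rw [hWa] at h2
  linarith

/-- If `z * L'(z)` is subordinate to `Q = z * K'(z)`, then `L` is subordinate to `K`. -/
lemma exists_subordination (hK : IsLogPrimitive K Q) (hQ : IsStarlikeUnivalent Q)
    {L : ℂ → ℂ} (hL : DifferentiableOn ℂ L unitDisk) (hL0 : L 0 = 0)
    (hm : ∀ z ∈ unitDisk, z * deriv L z ∈ Q '' unitDisk) :
    ∃ w : ℂ → ℂ, DifferentiableOn ℂ w unitDisk ∧ MapsTo w unitDisk unitDisk ∧ w 0 = 0 ∧
      ∀ z ∈ unitDisk, K (w z) = L z := by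
  have hmap : MapsTo L unitDisk (K '' unitDisk) := fun z hz => by
    obtain ⟨r, hzr, hr⟩ := exists_between (mem_unitDisk.1 hz)
    exact image_mono (ball_subset_ball hr.le)
      (hK.mem_image_ball_of_mul_deriv_mem hQ hL hL0 hm hr hzr)
  obtain ⟨-, g, hg, hg1, hg2⟩ := exists_differentiableOn_inverse hK.differentiableOn (hK.injOn hQ)
  refine ⟨g ∘ L, hg.comp hL hmap, fun z hz => (hg1 _ (hmap hz)).1, ?_,
    fun z hz => (hg1 _ (hmap hz)).2⟩
  have := hg2 0 zero_mem_unitDisk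
  rw [hK.map_zero] at this
  rw [Function.comp_apply, hL0, this]

end IsLogPrimitive

/-! ### Primitives along segments from the origin -/

/-- `integralFromZero h` is the primitive of a holomorphic function, also when the integrand is
altered at the origin. -/
lemma hasDerivAt_integralFromZero {h k : ℂ → ℂ} (hk : DifferentiableOn ℂ k unitDisk)
    (he : ∀ z ≠ 0, h z = k z) {z : ℂ} (hz : z ∈ unitDisk) :
    HasDerivAt (integralFromZero h) (k z) z := by
  obtain ⟨G, hG⟩ := DifferentiableOn.isExactOn_ball hk
  have key : ∀ w ∈ unitDisk, integralFromZero h w = G w - G 0 := by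
    intro w hw
    rcases eq_or_ne w 0 with rfl | hw0
    · simp [integralFromZero]
    have htw : ∀ t ∈ uIcc (0 : ℝ) 1, (t : ℂ) * w ∈ unitDisk := by
      intro t ht
      rw [uIcc_of_le zero_le_one] at ht
      exact mul_mem_unitDisk (by rw [Complex.norm_real, Real.norm_of_nonneg ht.1]; exact ht.2) hw
    have h1 : ∀ t ∈ uIcc (0 : ℝ) 1,
        HasDerivAt (fun t : ℝ => G ((t : ℂ) * w)) (w * k (t * w)) t := by
      intro t ht
      have h2 : HasDerivAt (fun t : ℂ => t * w) w (t : ℂ) := by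
        simpa using (hasDerivAt_id (t : ℂ)).mul_const w
      exact ((hG _ (htw t ht)).comp (t : ℂ) h2).comp_ofReal.congr_deriv (mul_comm _ _)
    have h3 : ContinuousOn (fun t : ℝ => w * k (t * w)) (uIcc (0 : ℝ) 1) :=
      continuousOn_const.mul (hk.continuousOn.comp (by fun_prop) htw)
    have h4 := intervalIntegral.integral_eq_sub_of_hasDerivAt h1 h3.intervalIntegrable
    -- The integrands can differ only at `t = 0`, which the half-open interval of integration omits.
    have h5 : integralFromZero h w = ∫ t in (0 : ℝ)..1, w * k (t * w) := by
      refine intervalIntegral.integral_congr_ae (Eventually.of_forall fun t ht => ?_)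
      rw [uIoc_of_le zero_le_one] at ht
      rw [he _ (mul_ne_zero (by exact_mod_cast ht.1.ne') hw0)]
    rw [h5, h4]
    simp
  refine ((hG z hz).sub_const (G 0)).congr_of_eventuallyEq ?_
  filter_upwards [isOpen_unitDisk.mem_nhds hz] with w hw using key w hw

lemma integralFromZero_zero (h : ℂ → ℂ) : integralFromZero h 0 = 0 := by
  simp [integralFromZero]

/-! ### The class `𝒞𝒱(Ω)` and its region of variability -/

namespace IsConformalOnto

variable {P : ℂ → ℂ} {Ω : Set ℂ}

lemma isStarlikeUnivalent (hP : IsConformalOnto P Ω) (hstar : StarConvex ℝ 1 Ω) (hP0 : P 0 = 1) :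
    IsStarlikeUnivalent (fun z => P z - 1) := by
  refine ⟨hP.1.sub_const 1, fun x hx y hy h => hP.2.injOn hx hy (sub_left_injective h),
    by simp [hP0], ?_⟩
  rintro _ ⟨z, hz, rfl⟩ α β hα hβ hαβ
  obtain ⟨w, hw, hwz⟩ := hP.2.surjOn (hstar (hP.2.mapsTo hz) hα hβ hαβ)
  refine ⟨w, hw, ?_⟩
  have : (α : ℂ) + β = 1 := by exact_mod_cast hαβ
  simp only [Complex.real_smul] at hwz ⊢
  linear_combination hwz + this

/-- The singularity of `(P ζ - 1) / ζ` at `0` is removable, and `dslope P 0` is its holomorphic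
extension. -/
lemma isLogPrimitive_extremalK (hP : IsConformalOnto P Ω) (hP0 : P 0 = 1) :
    IsLogPrimitive (extremalK P) (fun z => P z - 1) := by
  have hd : ∀ z ∈ unitDisk, HasDerivAt (extremalK P) (dslope P 0 z) z := fun z hz =>
    hasDerivAt_integralFromZero (h := fun ζ => ζ⁻¹ * (P ζ - 1)) ((Complex.differentiableOn_dslope
      (isOpen_unitDisk.mem_nhds zero_mem_unitDisk)).2 hP.1)
      (fun w hw => by rw [dslope_of_ne _ hw, slope_def_field, hP0, sub_zero, div_eq_inv_mul]) hz
  refine ⟨fun z hz => (hd z hz).differentiableAt.differentiableWithinAt,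
    integralFromZero_zero _, fun z hz => ?_⟩
  rw [(hd z hz).deriv]
  simpa [hP0] using sub_smul_dslope P 0 z

/-- A primitive of `exp (K (c z))`, `‖c‖ ≤ 1`, belongs to the class. -/
lemma mem_classCV_of_hasDerivAt (hP : IsConformalOnto P Ω) (hP0 : P 0 = 1) {c : ℂ} (hc : ‖c‖ ≤ 1)
    {f : ℂ → ℂ} (hf0 : f 0 = 0)
    (hf : ∀ z ∈ unitDisk, HasDerivAt f (Complex.exp (extremalK P (c * z))) z) :
    f ∈ ClassCV Ω ∧ IsLogDerivBranch f (fun z => extremalK P (c * z)) := by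
  have hK := hP.isLogPrimitive_extremalK hP0
  have hKc : ∀ z ∈ unitDisk, HasDerivAt (fun z => extremalK P (c * z))
      (deriv (extremalK P) (c * z) * c) z := fun z hz =>
    ((hK.hasDerivAt (mul_mem_unitDisk hc hz)).comp z
      ((hasDerivAt_id z).const_mul c)).congr_deriv (by rw [mul_one])
  have hdf : ∀ z ∈ unitDisk, deriv f z = Complex.exp (extremalK P (c * z)) :=
    fun z hz => (hf z hz).deriv
  refine ⟨⟨fun z hz => (hf z hz).differentiableAt.differentiableWithinAt, hf0, ?_,
    fun z hz => ⟨?_, ?_⟩⟩, fun z hz => (hKc z hz).differentiableAt.differentiableWithinAt,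
    by simp [hK.map_zero], fun z hz => (hdf z hz).symm⟩
  · rw [hdf 0 zero_mem_unitDisk, mul_zero, hK.map_zero, Complex.exp_zero]
  · rw [hdf z hz]
    exact Complex.exp_ne_zero _
  · have he : deriv f =ᶠ[𝓝 z] fun z => Complex.exp (extremalK P (c * z)) := by
      filter_upwards [isOpen_unitDisk.mem_nhds hz] with w hw using hdf w hw
    have h1 := hK.mul_deriv _ (mul_mem_unitDisk hc hz)
    have h2 : 1 + z * deriv (deriv f) z / deriv f z = P (c * z) := by
      rw [he.deriv_eq, (hKc z hz).cexp.deriv, hdf z hz, mul_left_comm,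
        mul_div_cancel_left₀ _ (Complex.exp_ne_zero _)]
      linear_combination h1
    rw [h2]
    exact hP.2.mapsTo (mul_mem_unitDisk hc hz)

/-- The logarithmic derivative branch of a function in the class is subordinate to `K`. -/
lemma exists_subordination (hP : IsConformalOnto P Ω) (hstar : StarConvex ℝ 1 Ω) (hP0 : P 0 = 1)
    {f L : ℂ → ℂ} (hf : f ∈ ClassCV Ω) (hL : IsLogDerivBranch f L) :
    ∃ w : ℂ → ℂ, DifferentiableOn ℂ w unitDisk ∧ MapsTo w unitDisk unitDisk ∧ w 0 = 0 ∧
      ∀ z ∈ unitDisk, extremalK P (w z) = L z := by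
  refine (hP.isLogPrimitive_extremalK hP0).exists_subordination
    (hP.isStarlikeUnivalent hstar hP0) hL.1 hL.2.1 fun z hz => ?_
  have hn : HasDerivAt L (deriv L z) z :=
    (hL.1.differentiableAt (isOpen_unitDisk.mem_nhds hz)).hasDerivAt
  have he : deriv f =ᶠ[𝓝 z] fun z => Complex.exp (L z) := by
    filter_upwards [isOpen_unitDisk.mem_nhds hz] with w hw using (hL.2.2 w hw).symm
  obtain ⟨v, hv, hvz⟩ := hP.2.surjOn (hf.2.2.2 z hz).2
  refine ⟨v, hv, ?_⟩
  have h1 : z * deriv (deriv f) z / deriv f z = z * deriv L z := by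
    rw [he.deriv_eq, hn.cexp.deriv, ← hL.2.2 z hz]
    have := Complex.exp_ne_zero (L z)
    field_simp
  simp only [hvz, h1]
  ring

/-- One inclusion is Schwarz's lemma for the subordinating function. For the other, a point `a` of
the closed disk is `c z₀` with `c = a / z₀`, `‖c‖ ≤ 1`, and a primitive of `exp (K (c z))` attains
`K a`. -/
lemma variabilityRegion_eq (hP : IsConformalOnto P Ω) (hstar : StarConvex ℝ 1 Ω) (hP0 : P 0 = 1)
    {z₀ : ℂ} (hz₀ : z₀ ∈ unitDisk) (hz₀' : z₀ ≠ 0) :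
    variabilityRegion Ω z₀ = extremalK P '' closedBall 0 ‖z₀‖ := by
  ext v
  constructor
  · rintro ⟨f, hf, L, hL, rfl⟩
    obtain ⟨w, hd, hm, h0, hw⟩ := hP.exists_subordination hstar hP0 hf hL
    exact ⟨w z₀, mem_closedBall_zero_iff.2 (norm_le_norm_of_mapsTo_unitDisk hd hm h0 hz₀),
      hw z₀ hz₀⟩
  · rintro ⟨a, ha, rfl⟩
    have hK := hP.isLogPrimitive_extremalK hP0
    have hc : ‖a / z₀‖ ≤ 1 := by
      rw [norm_div]
      exact div_le_one_of_le₀ (mem_closedBall_zero_iff.1 ha) (norm_nonneg _)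
    have hd : DifferentiableOn ℂ (fun z => Complex.exp (extremalK P (a / z₀ * z))) unitDisk :=
      (hK.differentiableOn.comp (differentiableOn_id.const_mul _)
        fun z hz => mul_mem_unitDisk hc hz).cexp
    obtain ⟨G, hG⟩ := DifferentiableOn.isExactOn_ball hd
    obtain ⟨h1, h2⟩ := hP.mem_classCV_of_hasDerivAt hP0 hc (f := fun z => G z - G 0) (sub_self _)
      fun z hz => (hG z hz).sub_const _
    exact ⟨_, h1, _, h2, by simp only [div_mul_cancel₀ a hz₀']⟩

lemma hasDerivAt_extremalF (hP : IsConformalOnto P Ω) (hP0 : P 0 = 1) {z : ℂ}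
    (hz : z ∈ unitDisk) : HasDerivAt (extremalF P) (Complex.exp (extremalK P z)) z :=
  hasDerivAt_integralFromZero (hP.isLogPrimitive_extremalK hP0).differentiableOn.cexp
    (fun _ _ => rfl) hz

lemma hasDerivAt_rotation_extremalF (hP : IsConformalOnto P Ω) (hP0 : P 0 = 1) {ε : ℂ}
    (hε : ‖ε‖ = 1) {z : ℂ} (hz : z ∈ unitDisk) :
    HasDerivAt (fun z => ε⁻¹ * extremalF P (ε * z)) (Complex.exp (extremalK P (ε * z))) z := by
  have hε0 : ε ≠ 0 := norm_ne_zero_iff.1 (by rw [hε]; exact one_ne_zero)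
  refine (((hP.hasDerivAt_extremalF hP0 (mul_mem_unitDisk hε.le hz)).comp z
    ((hasDerivAt_id z).const_mul ε)).const_mul ε⁻¹).congr_deriv ?_
  field_simp

end IsConformalOnto

theorem mainTheorem2 (Ω : Set ℂ) (hΩ : IsOpen Ω) (hstar : StarConvex ℝ 1 Ω)
    (P : ℂ → ℂ) (hP : IsConformalOnto P Ω) (hP0 : P 0 = 1)
    (z₀ : ℂ) (hz₀ : z₀ ∈ unitDisk) (hz₀' : z₀ ≠ 0) :
    (Convex ℝ (variabilityRegion Ω z₀) ∧ IsClosedJordanDomain (variabilityRegion Ω z₀)) ∧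
    variabilityRegion Ω z₀ = extremalK P '' Metric.closedBall 0 ‖z₀‖ ∧
    IsConvexUnivalent (extremalK P) ∧
    ∀ ε : ℂ, ‖ε‖ = 1 → ∀ f : ℂ → ℂ,
      (f ∈ ClassCV Ω ∧ ∃ L, IsLogDerivBranch f L ∧ L z₀ = extremalK P (ε * z₀)) ↔
        Set.EqOn f (fun z => ε⁻¹ * extremalF P (ε * z)) unitDisk := by
  have hQ := hP.isStarlikeUnivalent hstar hP0
  have hK := hP.isLogPrimitive_extremalK hP0
  have hV := hP.variabilityRegion_eq hstar hP0 hz₀ hz₀'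
  have hr0 : 0 < ‖z₀‖ := norm_pos_iff.2 hz₀'
  have hr : ‖z₀‖ < 1 := mem_unitDisk.1 hz₀
  refine ⟨⟨?_, ?_⟩, hV, hK.isConvexUnivalent hQ, fun ε hε f => ⟨?_, fun h => ?_⟩⟩
  · rw [hV]
    exact hK.convex_image_closedBall hQ hr0 hr
  · rw [hV]
    exact hK.isClosedJordanDomain_image hQ hr0 hr
  · rintro ⟨hf, L, hL, hLz⟩
    obtain ⟨w, hd, hm, h0, hw⟩ := hP.exists_subordination hstar hP0 hf hL
    -- Injectivity of `K` gives equality in Schwarz's lemma at `z₀`, so `w` is the rotation by `ε`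
    -- and `f' = exp (K (ε z))`.
    have hwz : w z₀ = ε * z₀ := hK.injOn hQ (hm hz₀) (mul_mem_unitDisk hε.le hz₀)
      ((hw z₀ hz₀).trans hLz)
    obtain ⟨c, -, hcw⟩ := exists_eqOn_rotation hd hm h0 hz₀ hz₀'
      (by rw [hwz, norm_mul, hε, one_mul])
    have hcε : c = ε := mul_right_cancel₀ hz₀' ((hcw hz₀).symm.trans hwz)
    subst hcε
    refine isOpen_unitDisk.eqOn_of_deriv_eq isPreconnected_unitDisk hf.1
      (fun z hz =>
        (hP.hasDerivAt_rotation_extremalF hP0 hε hz).differentiableAt.differentiableWithinAt)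
      (fun z hz => ?_) zero_mem_unitDisk ?_
    · rw [(hP.hasDerivAt_rotation_extremalF hP0 hε hz).deriv, ← hL.2.2 z hz, ← hw z hz, hcw hz]
    · rw [hf.2.1, mul_zero, extremalF, integralFromZero_zero, mul_zero]
  · have hd : ∀ z ∈ unitDisk, HasDerivAt f (Complex.exp (extremalK P (ε * z))) z := fun z hz =>
      (hP.hasDerivAt_rotation_extremalF hP0 hε hz).congr_of_eventuallyEq
        (h.eventuallyEq_of_mem (isOpen_unitDisk.mem_nhds hz))
    have hf0 : f 0 = 0 :=
      (h zero_mem_unitDisk).trans (by simp [extremalF, integralFromZero_zero])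
    obtain ⟨h1, h2⟩ := hP.mem_classCV_of_hasDerivAt hP0 hε.le hf0 hd
    exact ⟨h1, _, h2, rfl⟩
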